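/- Let $n\ge 1$. A Young function is a convex, strictly increasing function $f:[0,\infty)\to[0,\infty)$ with $f(0)=0$. A generalized Orlicz ball is a set of the form $K=\{x\in\mathbb R^n:\sum_{i=1}^n f_i(|x_i|)\le 1\}$ with Young functions $f_1,\dots,f_n$. Let $K\subset\mathbb R^n$ be a generalized Orlicz ball of volume $1$ in isotropic position, that is, if $X=(X_1,\dots,X_n)$ is uniformly distributed on $K$ (its law $\mathbb P_K$ is Lebesgue measure restricted to $K$), then $\mathbb E X_i=0$ and $\mathbb E X_iX_j=L_K^2\delta_{ij}$ for all $i,j$, where $L_K>0$ is a constant. Let $|\cdot|$ be the Euclidean norm. Then for every $t>0$ $$\mathbb P_K\Big(\Big|\frac{|X|^2}{n}-L_K^2\Big|\ge t\Big)\le\frac{5L_K^4}{nt^2}\qquad\text{and}\qquad \mathbb P_K\Big(\Big|\frac{|X|}{\sqrt n}-L_K\Big|\ge t\Big)\le\frac{5L_K^2}{nt^2}.$$ Consequently $K$ satisfies the $\varepsilon$-concentration hypothesis with $\varepsilon=\sqrt5\,n^{-1/3}$, that is, for this $\varepsilon$, $$\mathbb P_K\Big(\Big|\frac{|X|}{\sqrt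 n}-L_K\Big|\ge\varepsilon L_K\Big)\le\varepsilon.$$ -/

import Mathlib

open MeasureTheory

/-- A Young function: a convex (strictly) increasing function on `[0, ∞)` with `f 0 = 0`.
It is represented by a function on `ℝ` whose values at negative numbers are irrelevant;
on `[0, ∞)` it is automatically nonnegative. -/
structure IsYoungFunction (f : ℝ → ℝ) : Prop where
  convexOn : ConvexOn ℝ (Set.Ici 0) f
  strictMonoOn : StrictMonoOn f (Set.Ici 0)
  map_zero : f 0 = 0

/-- The set of points `x` of Euclidean space `ℝⁿ` with `∑ i, f i |x i| ≤ 1`. -/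
def orliczBall {n : ℕ} (f : Fin n → ℝ → ℝ) : Set (EuclideanSpace ℝ (Fin n)) :=
  {x | ∑ i, f i |x i| ≤ 1}

/-- `K` is a generalized Orlicz ball: it is given by some family of Young functions. -/
def IsGeneralizedOrliczBall {n : ℕ} (K : Set (EuclideanSpace ℝ (Fin n))) : Prop :=
  ∃ f : Fin n → ℝ → ℝ, (∀ i, IsYoungFunction (f i)) ∧ K = orliczBall f

/-- The uniform measure on a set `K` of volume one: Lebesgue measure restricted to `K`. -/
noncomputable def uniformMeasureOn {n : ℕ} (K : Set (EuclideanSpace ℝ (Fin n))) :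
    Measure (EuclideanSpace ℝ (Fin n)) :=
  volume.restrict K

/-- `K` has volume one and is in isotropic position with isotropic constant `L = L_K > 0`:
for `X` uniform on `K`, `𝔼 X_i = 0` and `𝔼 X_i X_j = L² δ_ij`. -/
structure IsIsotropicWith {n : ℕ} (K : Set (EuclideanSpace ℝ (Fin n))) (L : ℝ) : Prop where
  volume_eq_one : volume K = 1
  pos : 0 < L
  mean_eq_zero : ∀ i, ∫ x, x i ∂(uniformMeasureOn K) = 0
  cov_eq : ∀ i j, ∫ x, x i * x j ∂(uniformMeasureOn K) = if i = j then L ^ 2 else 0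

/-- The `ε`-concentration hypothesis for a body `K ⊆ ℝⁿ` with isotropic constant `L`:
`ℙ_K (| |X| / √n - L | ≥ ε L) ≤ ε`, for a given `ε > 0`. -/
def ConcentrationHypothesis {n : ℕ} (K : Set (EuclideanSpace ℝ (Fin n))) (L ε : ℝ) : Prop :=
  0 < ε ∧ (uniformMeasureOn K).real {x | ε * L ≤ |‖x‖ / √(n : ℝ) - L|} ≤ ε

/-! By Chebyshev's inequality it suffices that `|X|² / n` has variance at most `5 L⁴ / n`. Expanding
the square in coordinates, this follows from `𝔼 X_i² X_j² ≤ L⁴` for `i ≠ j` and `𝔼 X_i⁴ ≤ 6 L⁴`: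
only the `n` diagonal terms exceed `L⁴`, each by at most `5 L⁴`.

Both bounds come from slicing. The slice of a level-`r` Orlicz set at `x_i = s` is an Orlicz set in
one dimension less, at level `r - f_i |s|`. Its volume is log-concave in the level
(`logConcaveOn_volume_orliczSublevel`, by induction on dimension with a one-dimensional
Prékopa–Leindler inequality). So the density of `|X_i|` is log-concave, and comparison with an
exponential density gives the fourth moment (`LogConcaveOn.fourth_moment_le`). Log-concavity also
makes the mean of a squared coordinate increase with the level. A larger `|x_i|` lowers the level of
the slice, hence the mean of `x_j²` on it, and Chebyshev's association inequality turns this into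
negative correlation (`setIntegral_sq_mul_sq_le`). -/

/-- A real function is log-concave on `s` if it satisfies the multiplicative form of the concavity
inequality at all points of `s`. -/
def LogConcaveOn (s : Set ℝ) (g : ℝ → ℝ) : Prop :=
  ∀ ⦃x⦄, x ∈ s → ∀ ⦃y⦄, y ∈ s → ∀ ⦃a b : ℝ⦄, 0 < a → 0 < b → a + b = 1 →
    g x ^ a * g y ^ b ≤ g (a * x + b * y)

/-! ### Prékopa–Leindler for decreasing functions on the half line. -/

/-- A one-dimensional Brunn–Minkowski inequality for sets of nonnegative reals. -/
lemma ofReal_mul_volume_add_le {A B C : Set ℝ} {a b : ℝ} (ha : 0 < a) (hb : 0 < b)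
    (hA : A ⊆ Set.Ici 0) (hB : B ⊆ Set.Ici 0) (hA0 : A.Nonempty) (hB0 : B.Nonempty)
    (h : ∀ x ∈ A, ∀ y ∈ B, Set.Icc 0 (a * x + b * y) ⊆ C) :
    ENNReal.ofReal a * volume A + ENNReal.ofReal b * volume B ≤ volume C := by
  by_cases hC : volume C = ⊤
  · simp [hC]
  set c := (volume C).toReal
  -- The interval `[0, a x + b y]` lies in `C`, so `volume C` bounds `a x + b y`, hence also `a *
  -- sSup A + b * sSup B`. No measurability is needed.
  have hxy : ∀ x ∈ A, ∀ y ∈ B, a * x + b * y ≤ c := by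
    intro x hx y hy
    have h1 := measure_mono (μ := volume) (h x hx y hy)
    rw [Real.volume_Icc, sub_zero] at h1
    exact (ENNReal.ofReal_le_iff_le_toReal hC).1 h1
  obtain ⟨x₀, hx₀⟩ := hA0
  obtain ⟨y₀, hy₀⟩ := hB0
  have hAb : BddAbove A := ⟨(c - b * y₀) / a, fun x hx => by
    rw [le_div_iff₀ ha]; linarith [hxy x hx y₀ hy₀]⟩
  have hBb : BddAbove B := ⟨(c - a * x₀) / b, fun y hy => by
    rw [le_div_iff₀ hb]; linarith [hxy x₀ hx₀ y hy]⟩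
  have hsup1 : ∀ y ∈ B, sSup A ≤ (c - b * y) / a := fun y hy =>
    csSup_le ⟨x₀, hx₀⟩ fun x hx => by rw [le_div_iff₀ ha]; linarith [hxy x hx y hy]
  have hsup2 : sSup B ≤ (c - a * sSup A) / b :=
    csSup_le ⟨y₀, hy₀⟩ fun y hy => by
      have := hsup1 y hy
      rw [le_div_iff₀ ha] at this
      rw [le_div_iff₀ hb]; linarith
  rw [le_div_iff₀ hb] at hsup2
  have hA1 : volume A ≤ ENNReal.ofReal (sSup A) := by
    have : A ⊆ Set.Icc 0 (sSup A) := fun x hx => ⟨hA hx, le_csSup hAb hx⟩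
    simpa using measure_mono (μ := volume) this
  have hB1 : volume B ≤ ENNReal.ofReal (sSup B) := by
    have : B ⊆ Set.Icc 0 (sSup B) := fun x hx => ⟨hB hx, le_csSup hBb hx⟩
    simpa using measure_mono (μ := volume) this
  have hA2 : 0 ≤ sSup A := (hA hx₀).trans (le_csSup hAb hx₀)
  have hB2 : 0 ≤ sSup B := (hB hy₀).trans (le_csSup hBb hy₀)
  calc _ ≤ ENNReal.ofReal a * ENNReal.ofReal (sSup A)
        + ENNReal.ofReal b * ENNReal.ofReal (sSup B) := by gcongr
    _ = ENNReal.ofReal (a * sSup A + b * sSup B) := by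
      rw [← ENNReal.ofReal_mul ha.le, ← ENNReal.ofReal_mul hb.le, ENNReal.ofReal_add] <;> positivity
    _ ≤ volume C := (ENNReal.ofReal_le_iff_le_toReal hC).2 (by linarith)

/-- The Prékopa–Leindler inequality for decreasing functions normalised to be `1` at the origin, in
its additive form. -/
lemma add_mul_integral_le_of_antitoneOn {p q h : ℝ → ℝ} {a b : ℝ}
    (ha : 0 < a) (hb : 0 < b) (hab : a + b = 1)
    (hp : AntitoneOn p (Set.Ici 0)) (hq : AntitoneOn q (Set.Ici 0)) (hh : AntitoneOn h (Set.Ici 0))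
    (hp0 : ∀ x, 0 ≤ x → 0 ≤ p x) (hq0 : ∀ x, 0 ≤ x → 0 ≤ q x) (hh0 : ∀ x, 0 ≤ x → 0 ≤ h x)
    (hpi : IntegrableOn p (Set.Ici 0)) (hqi : IntegrableOn q (Set.Ici 0))
    (hhi : IntegrableOn h (Set.Ici 0)) (hp1 : p 0 = 1) (hq1 : q 0 = 1)
    (hpq : ∀ x, 0 ≤ x → ∀ y, 0 ≤ y → p x ^ a * q y ^ b ≤ h (a * x + b * y)) :
    a * (∫ x in Set.Ici 0, p x) + b * (∫ x in Set.Ici 0, q x) ≤ ∫ x in Set.Ici 0, h x := by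
  have ae0 : ∀ {f : ℝ → ℝ}, (∀ x, 0 ≤ x → 0 ≤ f x) → 0 ≤ᵐ[volume.restrict (Set.Ici 0)] f :=
    fun h => (ae_restrict_iff' measurableSet_Ici).2 (Filter.Eventually.of_forall fun x hx => h x hx)
  have lay : ∀ {f : ℝ → ℝ}, (∀ x, 0 ≤ x → 0 ≤ f x) → IntegrableOn f (Set.Ici 0) →
      ENNReal.ofReal (∫ x in Set.Ici 0, f x)
        = ∫⁻ t in Set.Ioi 0, volume ({x | t ≤ f x} ∩ Set.Ici 0) := by
    intro f hf hfi
    rw [ofReal_integral_eq_lintegral_ofReal hfi (ae0 hf),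
      lintegral_eq_lintegral_meas_le _ (ae0 hf) hfi.aestronglyMeasurable.aemeasurable]
    simp_rw [Measure.restrict_apply' measurableSet_Ici]
  have key : ENNReal.ofReal a * ENNReal.ofReal (∫ x in Set.Ici 0, p x)
      + ENNReal.ofReal b * ENNReal.ofReal (∫ x in Set.Ici 0, q x)
      ≤ ENNReal.ofReal (∫ x in Set.Ici 0, h x) := by
    rw [lay hp0 hpi, lay hq0 hqi, lay hh0 hhi, ← lintegral_const_mul' _ _ ENNReal.ofReal_ne_top,
      ← lintegral_const_mul' _ _ ENNReal.ofReal_ne_top]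
    refine (le_lintegral_add _ _).trans (setLIntegral_mono' measurableSet_Ioi fun t ht => ?_)
    have ht0 : 0 < t := ht
    -- The normalisation at `0` enters here: for `t ≤ 1` both superlevel sets contain `0`, as
    -- Brunn–Minkowski requires, and for `t > 1` both are empty.
    rcases le_or_gt t 1 with ht1 | ht1
    · refine ofReal_mul_volume_add_le ha hb Set.inter_subset_right Set.inter_subset_right
        ⟨0, by simpa [hp1]⟩ ⟨0, by simpa [hq1]⟩ ?_
      rintro x ⟨hx, hx0⟩ y ⟨hy, hy0⟩ z ⟨hz0, hz⟩
      refine ⟨?_, hz0⟩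
      calc t = t ^ a * t ^ b := by rw [← Real.rpow_add ht0, hab, Real.rpow_one]
        _ ≤ p x ^ a * q y ^ b := by
          have hx : t ≤ p x := hx
          have hy : t ≤ q y := hy
          exact mul_le_mul (Real.rpow_le_rpow ht0.le hx ha.le) (Real.rpow_le_rpow ht0.le hy hb.le)
            (by positivity) (Real.rpow_nonneg (hp0 x hx0) _)
        _ ≤ h (a * x + b * y) := hpq x hx0 y hy0
        _ ≤ h z := hh hz0 (hz0.trans hz) hz
    · have e : ∀ {f : ℝ → ℝ}, AntitoneOn f (Set.Ici 0) → f 0 = 1 →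
          {x | t ≤ f x} ∩ Set.Ici 0 = ∅ := by
        intro f hf hf1
        refine Set.eq_empty_of_forall_notMem fun x ⟨hx, hx0⟩ => ?_
        have h1 : t ≤ f x := hx
        have h2 := hf Set.self_mem_Ici hx0 hx0
        linarith
      simp [e hp hp1, e hq hq1]
  have ip := integral_nonneg_of_ae (ae0 hp0)
  have iq := integral_nonneg_of_ae (ae0 hq0)
  have ih := integral_nonneg_of_ae (ae0 hh0)
  rwa [← ENNReal.ofReal_mul ha.le, ← ENNReal.ofReal_mul hb.le,
    ← ENNReal.ofReal_add (by positivity) (by positivity), ENNReal.ofReal_le_ofReal_iff ih] at key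

/-- The Prékopa–Leindler inequality for decreasing functions on `[0, ∞)`. -/
lemma rpow_integral_mul_le_of_antitoneOn {p q h : ℝ → ℝ} {a b : ℝ}
    (ha : 0 < a) (hb : 0 < b) (hab : a + b = 1)
    (hp : AntitoneOn p (Set.Ici 0)) (hq : AntitoneOn q (Set.Ici 0)) (hh : AntitoneOn h (Set.Ici 0))
    (hp0 : ∀ x, 0 ≤ x → 0 ≤ p x) (hq0 : ∀ x, 0 ≤ x → 0 ≤ q x) (hh0 : ∀ x, 0 ≤ x → 0 ≤ h x)
    (hpi : IntegrableOn p (Set.Ici 0)) (hqi : IntegrableOn q (Set.Ici 0))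
    (hhi : IntegrableOn h (Set.Ici 0))
    (hpq : ∀ x, 0 ≤ x → ∀ y, 0 ≤ y → p x ^ a * q y ^ b ≤ h (a * x + b * y)) :
    (∫ x in Set.Ici 0, p x) ^ a * (∫ x in Set.Ici 0, q x) ^ b ≤ ∫ x in Set.Ici 0, h x := by
  have ih : 0 ≤ ∫ x in Set.Ici 0, h x :=
    setIntegral_nonneg measurableSet_Ici fun x hx => hh0 x hx
  have zero : ∀ {f : ℝ → ℝ}, AntitoneOn f (Set.Ici 0) → (∀ x, 0 ≤ x → 0 ≤ f x) → f 0 = 0 →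
      ∫ x in Set.Ici 0, f x = 0 := fun {f} hf hf0 h0 =>
    setIntegral_eq_zero_of_forall_eq_zero fun x hx =>
      le_antisymm (h0 ▸ hf Set.self_mem_Ici hx hx) (hf0 x hx)
  rcases (hp0 0 le_rfl).eq_or_lt with hP | hP
  · rwa [zero hp hp0 hP.symm, Real.zero_rpow ha.ne', zero_mul]
  rcases (hq0 0 le_rfl).eq_or_lt with hQ | hQ
  · rwa [zero hq hq0 hQ.symm, Real.zero_rpow hb.ne', mul_zero]
  have hH : 0 < p 0 ^ a * q 0 ^ b := by positivity
  have ip : 0 ≤ ∫ x in Set.Ici 0, p x :=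
    setIntegral_nonneg measurableSet_Ici fun x hx => hp0 x hx
  have iq : 0 ≤ ∫ x in Set.Ici 0, q x :=
    setIntegral_nonneg measurableSet_Ici fun x hx => hq0 x hx
  have scale : ∀ {f : ℝ → ℝ} {c : ℝ}, 0 < c → AntitoneOn f (Set.Ici 0) →
      AntitoneOn (fun x => f x / c) (Set.Ici 0) := fun hc hf x hx y hy hxy =>
    div_le_div_of_nonneg_right (hf hx hy hxy) hc.le
  -- Dividing by the maxima `p 0` and `q 0` gives the additive form; the weighted AM–GM inequality
  -- then yields the multiplicative one.
  have key := add_mul_integral_le_of_antitoneOn (p := fun x => p x / p 0)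
    (q := fun x => q x / q 0) (h := fun x => h x / (p 0 ^ a * q 0 ^ b)) ha hb hab
    (scale hP hp) (scale hQ hq) (scale hH hh)
    (fun x hx => div_nonneg (hp0 x hx) hP.le) (fun x hx => div_nonneg (hq0 x hx) hQ.le)
    (fun x hx => div_nonneg (hh0 x hx) hH.le) (hpi.div_const _) (hqi.div_const _)
    (hhi.div_const _) (div_self hP.ne') (div_self hQ.ne') (fun x hx y hy => by
      rw [Real.div_rpow (hp0 x hx) hP.le, Real.div_rpow (hq0 y hy) hQ.le, div_mul_div_comm]
      exact div_le_div_of_nonneg_right (hpq x hx y hy) hH.le)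
  rw [integral_div, integral_div, integral_div] at key
  have amgm := Real.geom_mean_le_arith_mean2_weighted ha.le hb.le (div_nonneg ip hP.le)
    (div_nonneg iq hQ.le) hab
  rw [Real.div_rpow ip hP.le, Real.div_rpow iq hQ.le, div_mul_div_comm] at amgm
  exact (div_le_div_iff_of_pos_right hH).1 (amgm.trans key)

/-! ### Log-concave functions and their moments. -/

/-- A log-concave function is a Pólya frequency function of order two. -/
lemma LogConcaveOn.mul_le_mul_of_add_eq {g : ℝ → ℝ} (hg : LogConcaveOn Set.univ g) (hg0 : ∀ x, 0 ≤ g x)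
    {x y z w : ℝ} (hxy : x ≤ y) (hxz : x ≤ z) (h : x + w = y + z) :
    g x * g w ≤ g y * g z := by
  rcases hxy.eq_or_lt with rfl | hxy
  · rw [add_left_cancel h]
  rcases hxz.eq_or_lt with rfl | hxz
  · rw [show w = y by linarith, mul_comm]
  have hw : 0 < w - x := by linarith
  have ha : 0 < (w - y) / (w - x) := div_pos (by linarith) hw
  have hb : 0 < (y - x) / (w - x) := div_pos (by linarith) hw
  have hab : (w - y) / (w - x) + (y - x) / (w - x) = 1 := by
    rw [← add_div, div_eq_one_iff_eq hw.ne']; ring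
  -- `y` and `z` are convex combinations of `x` and `w` with exchanged weights, so the two
  -- inequalities multiply to the claim.
  have h1 := hg (Set.mem_univ x) (Set.mem_univ w) ha hb hab
  have h2 := hg (Set.mem_univ x) (Set.mem_univ w) hb ha (by rwa [add_comm])
  have e1 : (w - y) / (w - x) * x + (y - x) / (w - x) * w = y := by field_simp; ring
  have e2 : (y - x) / (w - x) * x + (w - y) / (w - x) * w = z := by
    obtain rfl : z = x + w - y := by linarith
    field_simp; ring
  rw [e1] at h1
  rw [e2] at h2
  set a := (w - y) / (w - x)
  set b := (y - x) / (w - x)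
  have split : ∀ t : ℝ, 0 ≤ t → t = t ^ a * t ^ b := fun t ht => by
    rw [← Real.rpow_add_of_nonneg ht ha.le hb.le, hab, Real.rpow_one]
  calc g x * g w = (g x ^ a * g w ^ b) * (g x ^ b * g w ^ a) := by
        conv_lhs => rw [split _ (hg0 x), split _ (hg0 w)]
        ring
    _ ≤ g y * g z := by
      have := hg0 x; have := hg0 w
      exact _root_.mul_le_mul h1 h2 (by positivity) (hg0 y)

/-- Composing an increasing log-concave function with a concave function. -/
lemma LogConcaveOn.comp_const_sub {g f : ℝ → ℝ} (hg : LogConcaveOn Set.univ g) (hm : Monotone g)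
    (hf : ConvexOn ℝ (Set.Ici 0) f) (r : ℝ) : LogConcaveOn (Set.Ici 0) fun s => g (r - f s) := by
  intro x hx y hy a b ha hb hab
  refine (hg (Set.mem_univ _) (Set.mem_univ _) ha hb hab).trans (hm ?_)
  have := hf.2 hx hy ha.le hb.le hab
  simp only [smul_eq_mul] at this
  have e : r = a * r + b * r := by rw [← add_mul, hab, one_mul]
  linarith

lemma integral_pow_mul_exp_neg_mul_Ioi (k : ℕ) {r : ℝ} (hr : 0 < r) :
    ∫ t in Set.Ioi 0, t ^ k * Real.exp (-(r * t)) = k.factorial / r ^ (k + 1) := by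
  have h := Real.integral_rpow_mul_exp_neg_mul_Ioi (a := k + 1) (by positivity) hr
  rw [Real.Gamma_nat_eq_factorial] at h
  simp only [add_sub_cancel_right, Real.rpow_natCast] at h
  rw [h]
  norm_cast
  rw [one_div, inv_pow]
  field_simp

lemma integrableOn_pow_mul_exp_neg_mul_Ioi (k : ℕ) {r : ℝ} (hr : 0 < r) :
    IntegrableOn (fun t => t ^ k * Real.exp (-(r * t))) (Set.Ioi 0) := by
  refine not_imp_comm.1 integral_undef ?_
  rw [integral_pow_mul_exp_neg_mul_Ioi k hr]
  positivity

/-- Among log-concave densities on the half line, the exponential ones have the largest fourth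
moment for given total mass and second moment. -/
lemma LogConcaveOn.fourth_moment_le {g : ℝ → ℝ} {R : ℝ} (hg : LogConcaveOn (Set.Ici 0) g)
    (hR : ∀ s, R < s → g s = 0)
    (hi : ∀ k : ℕ, IntegrableOn (fun s => s ^ k * g s) (Set.Ioi 0))
    (h0 : 0 < ∫ s in Set.Ioi 0, g s) (h2 : 0 < ∫ s in Set.Ioi 0, s ^ 2 * g s) :
    (∫ s in Set.Ioi 0, s ^ 4 * g s) * ∫ s in Set.Ioi 0, g s
      ≤ 6 * (∫ s in Set.Ioi 0, s ^ 2 * g s) ^ 2 := by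
  set m0 := ∫ s in Set.Ioi 0, g s
  set m2 := ∫ s in Set.Ioi 0, s ^ 2 * g s
  set m4 := ∫ s in Set.Ioi 0, s ^ 4 * g s
  -- With this rate, `α m0 exp (-α s)` has the same mass `m0` and second moment `2 m0 / α² = m2` as
  -- `g`; its fourth moment is `24 m0 / α⁴ = 6 m2² / m0`.
  set α := √(2 * m0 / m2)
  have hα : 0 < α := Real.sqrt_pos.2 (by positivity)
  have hα2 : α ^ 2 * m2 = 2 * m0 := by
    rw [Real.sq_sqrt (by positivity)]; field_simp
  set e : ℝ → ℝ := fun s => α * m0 * Real.exp (-(α * s)) with he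
  have epos : ∀ s, 0 < e s := fun s => by positivity
  have emul : ∀ x y a b : ℝ, a + b = 1 → e x ^ a * e y ^ b = e (a * x + b * y) := by
    intro x y a b hab
    have hc : 0 < α * m0 := by positivity
    simp only [he]
    rw [Real.mul_rpow hc.le (Real.exp_pos _).le, Real.mul_rpow hc.le (Real.exp_pos _).le,
      ← Real.exp_mul, ← Real.exp_mul, mul_mul_mul_comm, ← Real.rpow_add hc, hab, Real.rpow_one,
      ← Real.exp_add]
    congr 2; ring
  set I : Set ℝ := {s | 0 ≤ s ∧ e s ≤ g s} with hI
  have Imem : ∀ x ∈ I, ∀ y ∈ I, ∀ s, x < s → s < y → e s ≤ g s := by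
    intro x hx y hy s hxs hsy
    have hyx : 0 < y - x := by linarith
    have ha : 0 < (y - s) / (y - x) := div_pos (by linarith) hyx
    have hb : 0 < (s - x) / (y - x) := div_pos (by linarith) hyx
    have hab : (y - s) / (y - x) + (s - x) / (y - x) = 1 := by
      rw [← add_div, div_eq_one_iff_eq hyx.ne']; ring
    have e1 : (y - s) / (y - x) * x + (s - x) / (y - x) * y = s := by field_simp; ring
    have h1 := hg hx.1 hy.1 ha hb hab
    have h2 := emul x y _ _ hab
    rw [e1] at h1 h2
    rw [← h2]
    refine le_trans ?_ h1
    have := hx.2; have := hy.2; have := epos x; have := epos y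
    exact mul_le_mul (Real.rpow_le_rpow (by linarith) ‹e x ≤ g x› ha.le)
      (Real.rpow_le_rpow (by linarith) ‹e y ≤ g y› hb.le) (by positivity)
      (Real.rpow_nonneg (by linarith) _)
  -- Since `log e` is affine, `{g ≥ e}` is an interval, so `g - e` is nonnegative strictly between
  -- its endpoints `u`, `v` and negative outside. If it is empty, `u = v = 0` serves.
  obtain ⟨u, v, hu, huv, hsign⟩ : ∃ u v : ℝ, 0 ≤ u ∧ u ≤ v ∧
      ∀ s, 0 < s → (g s - e s) * ((s ^ 2 - u ^ 2) * (s ^ 2 - v ^ 2)) ≤ 0 := by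
    rcases I.eq_empty_or_nonempty with hIe | hIn
    · refine ⟨0, 0, le_rfl, le_rfl, fun s hs => ?_⟩
      have : ¬ e s ≤ g s := fun h => Set.notMem_empty s (hIe ▸ ⟨hs.le, h⟩)
      refine mul_nonpos_of_nonpos_of_nonneg (by linarith) ?_
      rw [zero_pow two_ne_zero, sub_zero]
      positivity
    · have hbb : BddBelow I := ⟨0, fun s hs => hs.1⟩
      have hba : BddAbove I := ⟨R, fun s hs => by
        by_contra hlt
        have := hs.2
        rw [hR s (not_le.1 hlt)] at this
        exact absurd this (not_le.2 (epos s))⟩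
      have hu : 0 ≤ sInf I := le_csInf hIn fun s hs => hs.1
      have huv : sInf I ≤ sSup I := csInf_le_csSup hIn hbb hba
      refine ⟨sInf I, sSup I, hu, huv, fun s hs => ?_⟩
      rcases lt_or_ge s (sInf I) with h1 | h1
      · have : ¬ e s ≤ g s := fun h => notMem_of_lt_csInf h1 hbb ⟨hs.le, h⟩
        refine mul_nonpos_of_nonpos_of_nonneg (by linarith)
          (mul_nonneg_of_nonpos_of_nonpos ?_ ?_) <;> nlinarith
      rcases lt_or_ge (sSup I) s with h2 | h2
      · have : ¬ e s ≤ g s := fun h => notMem_of_csSup_lt h2 hba ⟨hs.le, h⟩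
        refine mul_nonpos_of_nonpos_of_nonneg (by linarith) (mul_nonneg ?_ ?_) <;> nlinarith
      rcases h1.eq_or_lt with h1 | h1
      · simp [← h1]
      rcases h2.eq_or_lt with h2 | h2
      · simp [← h2]
      obtain ⟨x, hx, hxs⟩ := exists_lt_of_csInf_lt hIn h1
      obtain ⟨y, hy, hsy⟩ := exists_lt_of_lt_csSup hIn h2
      have := Imem x hx y hy s hxs hsy
      refine mul_nonpos_of_nonneg_of_nonpos (by linarith)
        (mul_nonpos_of_nonneg_of_nonpos ?_ ?_) <;> nlinarith
  have hei : ∀ k : ℕ, IntegrableOn (fun s => s ^ k * e s) (Set.Ioi 0) := fun k => by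
    refine IntegrableOn.congr_fun
      ((integrableOn_pow_mul_exp_neg_mul_Ioi k hα).const_mul (α * m0))
      (fun s _ => ?_) measurableSet_Ioi
    simp only [he]; ring
  have hem : ∀ k : ℕ, ∫ s in Set.Ioi 0, s ^ k * e s = α * m0 * (k.factorial / α ^ (k + 1)) := by
    intro k
    rw [← integral_pow_mul_exp_neg_mul_Ioi k hα, ← integral_const_mul]
    congr 1; ext s; simp only [he]; ring
  have hd : ∀ k : ℕ, IntegrableOn (fun s => s ^ k * g s - s ^ k * e s) (Set.Ioi 0) :=
    fun k => (hi k).sub (hei k)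
  -- Integrating the sign condition, the terms of order `2` and `0` cancel because those moments
  -- agree, leaving only the fourth moments.
  have hle : ∫ s in Set.Ioi 0, ((s ^ 4 * g s - s ^ 4 * e s)
      - (u ^ 2 + v ^ 2) * (s ^ 2 * g s - s ^ 2 * e s)
      + u ^ 2 * v ^ 2 * (s ^ 0 * g s - s ^ 0 * e s)) ≤ 0 := by
    refine setIntegral_nonpos measurableSet_Ioi fun s hs => ?_
    have := hsign s hs
    nlinarith
  rw [integral_add (by exact (hd 4).sub ((hd 2).const_mul _)) (by exact (hd 0).const_mul _),
    integral_sub (hd 4) (by exact (hd 2).const_mul _), integral_const_mul, integral_const_mul,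
    integral_sub (hi 4) (hei 4), integral_sub (hi 2) (hei 2), integral_sub (hi 0) (hei 0),
    hem, hem, hem] at hle
  simp only [pow_zero, one_mul] at hle
  change m4 - _ - (u ^ 2 + v ^ 2) * (m2 - _) + u ^ 2 * v ^ 2 * (m0 - _) ≤ 0 at hle
  have e0 : α * m0 * ((Nat.factorial 0 : ℝ) / α ^ (0 + 1)) = m0 := by
    simp; field_simp
  have e2 : α * m0 * ((Nat.factorial 2 : ℝ) / α ^ (2 + 1)) = m2 := by
    rw [show (Nat.factorial 2 : ℝ) = 2 by norm_num [Nat.factorial]]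
    field_simp
    linear_combination (-α) * hα2
  rw [e0, e2] at hle
  have e4 : α * m0 * ((Nat.factorial 4 : ℝ) / α ^ (4 + 1)) * m0 = 6 * m2 ^ 2 := by
    rw [show (Nat.factorial 4 : ℝ) = 24 by norm_num [Nat.factorial]]
    field_simp
    linear_combination (-6 * α) * (α ^ 2 * m2 + 2 * m0) * hα2
  rw [← e4]
  exact mul_le_mul_of_nonneg_right (by linarith) h0.le

/-! ### Chebyshev's association inequality. -/

/-- Chebyshev's association inequality: if `φ` and `a / b` are oppositely ordered, the mean of `φ`
with respect to `a` is at most its mean with respect to `b`. -/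
lemma integral_mul_mul_integral_le_of_antivary {α : Type*} [MeasurableSpace α] {μ : Measure α}
    [SFinite μ] {φ a b : α → ℝ} (ha : Integrable a μ) (hb : Integrable b μ)
    (hφa : Integrable (fun x => φ x * a x) μ) (hφb : Integrable (fun x => φ x * b x) μ)
    (h : ∀ x y, φ x ≤ φ y → a y * b x ≤ a x * b y) :
    (∫ x, φ x * a x ∂μ) * ∫ x, b x ∂μ ≤ (∫ x, φ x * b x ∂μ) * ∫ x, a x ∂μ := by
  -- The integrand is `(φ x - φ y) (a x b y - b x a y)` at `z = (x, y)`.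
  have hle : ∫ z, (φ z.1 * a z.1 * b z.2 - φ z.1 * b z.1 * a z.2
      - (a z.1 * (φ z.2 * b z.2) - b z.1 * (φ z.2 * a z.2))) ∂(μ.prod μ) ≤ 0 := by
    refine integral_nonpos fun z => ?_
    rcases le_total (φ z.1) (φ z.2) with hz | hz
    · have := h _ _ hz
      change _ ≤ (0 : ℝ)
      nlinarith [mul_nonneg (sub_nonneg.2 hz) (sub_nonneg.2 this)]
    · have := h _ _ hz
      change _ ≤ (0 : ℝ)
      nlinarith [mul_nonneg (sub_nonneg.2 hz) (sub_nonneg.2 this)]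
  rw [integral_sub (by exact (hφa.mul_prod hb).sub (hφb.mul_prod ha))
      (by exact (ha.mul_prod hφb).sub (hb.mul_prod hφa)),
    integral_sub (by exact hφa.mul_prod hb) (by exact hφb.mul_prod ha),
    integral_sub (by exact ha.mul_prod hφb) (by exact hb.mul_prod hφa),
    integral_prod_mul (fun x => φ x * a x) b, integral_prod_mul (fun x => φ x * b x) a,
    integral_prod_mul a (fun x => φ x * b x), integral_prod_mul b (fun x => φ x * a x)] at hle
  linarith

/-! ### Young functions and the sublevel sets of their sums. -/

lemma IsYoungFunction.monotone_comp_max {f : ℝ → ℝ} (hf : IsYoungFunction f) :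
    Monotone fun s => f (max s 0) := fun _ _ hxy =>
  hf.strictMonoOn.monotoneOn (Set.mem_Ici.2 (le_max_right _ _))
    (Set.mem_Ici.2 (le_max_right _ _)) (max_le_max_right 0 hxy)

lemma IsYoungFunction.nonneg {f : ℝ → ℝ} (hf : IsYoungFunction f) {s : ℝ} (hs : 0 ≤ s) :
    0 ≤ f s :=
  hf.map_zero ▸ hf.strictMonoOn.monotoneOn Set.self_mem_Ici hs hs

lemma IsYoungFunction.measurable_comp_abs {f : ℝ → ℝ} (hf : IsYoungFunction f) :
    Measurable fun s => f |s| := by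
  simpa [Function.comp_def] using hf.monotone_comp_max.measurable.comp (measurable_norm (α := ℝ))

/-- Convexity and `f 0 = 0` give `s * f 1 ≤ f s` for `s ≥ 1`, so growth is at least linear. This is
what makes Orlicz sets bounded and all moments finite. -/
lemma IsYoungFunction.exists_bound {f : ℝ → ℝ} (hf : IsYoungFunction f) (r : ℝ) :
    ∃ R, ∀ s, 0 ≤ s → f s ≤ r → s ≤ R := by
  have h1 : 0 < f 1 := hf.map_zero ▸ hf.strictMonoOn Set.self_mem_Ici
    (Set.mem_Ici.2 zero_le_one) one_pos
  refine ⟨max 1 (r / f 1), fun s hs hsr => ?_⟩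
  rcases le_or_gt s 1 with h | h
  · exact h.trans (le_max_left _ _)
  · refine le_trans ?_ (le_max_right _ _)
    have hs0 : 0 < s := by linarith
    have h2 := hf.convexOn.2 (Set.mem_Ici.2 hs) (Set.mem_Ici.2 (le_refl (0 : ℝ)))
      (by positivity : 0 ≤ 1 / s)
      (by rw [sub_nonneg, div_le_one hs0]; exact h.le : 0 ≤ 1 - 1 / s) (by ring)
    simp only [smul_eq_mul, mul_zero, add_zero, hf.map_zero] at h2
    rw [one_div_mul_cancel hs0.ne', one_div_mul_eq_div, le_div_iff₀ hs0] at h2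
    rw [le_div_iff₀ h1]
    linarith

/-- The sublevel sets of `x ↦ ∑ i, f i |x i|` in the plain product space `ℝᵐ`. -/
def orliczSublevel {m : ℕ} (f : Fin m → ℝ → ℝ) (r : ℝ) : Set (Fin m → ℝ) :=
  {x | ∑ i, f i |x i| ≤ r}

section Sublevel

variable {m : ℕ} {f : Fin m → ℝ → ℝ}

lemma measurableSet_orliczSublevel (hf : ∀ i, IsYoungFunction (f i)) (r : ℝ) :
    MeasurableSet (orliczSublevel f r) :=
  measurableSet_le (Finset.measurable_sum _ fun i _ =>
    (hf i).measurable_comp_abs.comp (measurable_pi_apply i)) measurable_const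

lemma exists_orliczSublevel_subset_Icc (hf : ∀ i, IsYoungFunction (f i)) (r : ℝ) :
    ∃ R : Fin m → ℝ, orliczSublevel f r ⊆ Set.Icc (-R) R := by
  choose R hR using fun i => (hf i).exists_bound r
  refine ⟨R, fun x hx => ?_⟩
  have h : ∀ i, |x i| ≤ R i := fun i => hR i _ (abs_nonneg _) <|
    (Finset.single_le_sum (f := fun i => f i |x i|)
      (fun j _ => (hf j).nonneg (abs_nonneg _)) (Finset.mem_univ i)).trans hx
  exact ⟨fun i => (abs_le.1 (h i)).1, fun i => (abs_le.1 (h i)).2⟩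

lemma Continuous.integrableOn_orliczSublevel (hf : ∀ i, IsYoungFunction (f i)) (r : ℝ)
    {G : (Fin m → ℝ) → ℝ} (hG : Continuous G) : IntegrableOn G (orliczSublevel f r) := by
  obtain ⟨R, hR⟩ := exists_orliczSublevel_subset_Icc hf r
  exact hG.integrableOn_Icc.mono_set hR

lemma volume_orliczSublevel_ne_top (hf : ∀ i, IsYoungFunction (f i)) (r : ℝ) :
    volume (orliczSublevel f r) ≠ ⊤ := by
  obtain ⟨R, hR⟩ := exists_orliczSublevel_subset_Icc hf r
  exact measure_ne_top_of_subset hR isCompact_Icc.measure_ne_top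

lemma volume_orliczSublevel_of_neg (hf : ∀ i, IsYoungFunction (f i)) {r : ℝ} (hr : r < 0) :
    volume.real (orliczSublevel f r) = 0 := by
  have : orliczSublevel f r = ∅ := Set.eq_empty_of_forall_notMem fun x hx =>
    (lt_of_le_of_lt hx hr).not_ge (Finset.sum_nonneg fun i _ => (hf i).nonneg (abs_nonneg _))
  simp [this]

lemma monotone_volume_orliczSublevel (hf : ∀ i, IsYoungFunction (f i)) :
    Monotone fun r => volume.real (orliczSublevel f r) := fun _ s hrs =>
  measureReal_mono (fun _ hx => le_trans hx hrs) (volume_orliczSublevel_ne_top hf s)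

end Sublevel

/-! ### Slicing along one coordinate. -/

section Slice

variable {m : ℕ} {f : Fin (m + 1) → ℝ → ℝ}

/-- Fubini in the `i`-th coordinate: fixing `x i = s` uses up `f i |s|` of the level `r`, leaving a
sublevel set of the other coordinates. -/
lemma orliczSublevel_slice (hf : ∀ i, IsYoungFunction (f i)) (r : ℝ) (i : Fin (m + 1))
    {G : ℝ × (Fin m → ℝ) → ℝ} (hG : Continuous G) :
    Integrable (fun s => ∫ y in orliczSublevel (i.removeNth f) (r - f i |s|), G (s, y)) ∧
    ∫ x in orliczSublevel f r, G (x i, i.removeNth x) =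
      ∫ s, ∫ y in orliczSublevel (i.removeNth f) (r - f i |s|), G (s, y) := by
  set e := MeasurableEquiv.piFinSuccAbove (fun _ : Fin (m + 1) => ℝ) i
  have hmp : MeasurePreserving e := volume_preserving_piFinSuccAbove (fun _ => ℝ) i
  set T : Set (ℝ × (Fin m → ℝ)) := e.symm ⁻¹' orliczSublevel f r
  have hT : MeasurableSet T := e.symm.measurable (measurableSet_orliczSublevel hf r)
  have hS : orliczSublevel f r = e ⁻¹' T := by
    ext x; simp [T]
  have hTmem : ∀ s y, (s, y) ∈ T ↔ y ∈ orliczSublevel (i.removeNth f) (r - f i |s|) := by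
    intro s y
    change ∑ j, f j |i.insertNth (α := fun _ => ℝ) s y j| ≤ r ↔
      ∑ k, f (i.succAbove k) |y k| ≤ r - f i |s|
    rw [Fin.sum_univ_succAbove _ i, le_sub_iff_add_le']
    simp
  have hGe : Continuous fun x : Fin (m + 1) → ℝ => G (x i, i.removeNth x) := by
    refine hG.comp ((continuous_apply i).prodMk (continuous_pi fun k => ?_))
    exact continuous_apply (i.succAbove k)
  have hint : IntegrableOn G T := by
    refine (hmp.integrableOn_comp_preimage e.measurableEmbedding).1 ?_
    rw [← hS]
    exact hGe.integrableOn_orliczSublevel hf r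
  have hind : ∀ s, ∫ y, T.indicator G (s, y)
      = ∫ y in orliczSublevel (i.removeNth f) (r - f i |s|), G (s, y) := by
    intro s
    have hf' : ∀ k, IsYoungFunction (i.removeNth f k) := fun k => hf _
    rw [← integral_indicator (measurableSet_orliczSublevel hf' _)]
    congr 1; ext y
    by_cases h : (s, y) ∈ T
    · rw [Set.indicator_of_mem h, Set.indicator_of_mem ((hTmem s y).1 h)]
    · rw [Set.indicator_of_notMem h, Set.indicator_of_notMem fun h' => h ((hTmem s y).2 h')]
  have hint' : Integrable (T.indicator G) (volume.prod volume) := hint.integrable_indicator hT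
  simp_rw [← hind]
  refine ⟨hint'.integral_prod_left, ?_⟩
  rw [← integral_prod _ hint', hS]
  exact (hmp.setIntegral_preimage_emb e.measurableEmbedding G T).trans
    (integral_indicator hT).symm

/-- Moments of a coordinate over an Orlicz sublevel set. -/
lemma integrable_pow_mul_volume_slice (hf : ∀ i, IsYoungFunction (f i)) (r : ℝ) (i : Fin (m + 1))
    (k : ℕ) :
    Integrable fun s => s ^ k * volume.real (orliczSublevel (i.removeNth f) (r - f i |s|)) := by
  refine (orliczSublevel_slice hf r i (G := fun z => z.1 ^ k) (by fun_prop)).1.congr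
    (Filter.Eventually.of_forall fun s => ?_)
  simp [mul_comm]

lemma setIntegral_coord_pow (hf : ∀ i, IsYoungFunction (f i)) (r : ℝ) (i : Fin (m + 1))
    (k : ℕ) :
    ∫ x in orliczSublevel f r, x i ^ k =
      ∫ s, s ^ k * volume.real (orliczSublevel (i.removeNth f) (r - f i |s|)) := by
  rw [(orliczSublevel_slice hf r i (G := fun z => z.1 ^ k) (by fun_prop)).2]
  simp [mul_comm]

lemma volume_orliczSublevel_succ (hf : ∀ i, IsYoungFunction (f i)) (r : ℝ) (i : Fin (m + 1)) :
    volume.real (orliczSublevel f r) =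
      2 * ∫ s in Set.Ioi 0, volume.real (orliczSublevel (i.removeNth f) (r - f i s)) := by
  have := setIntegral_coord_pow hf r i 0
  rw [← integral_comp_abs (f := fun s => volume.real (orliczSublevel (i.removeNth f) (r - f i s)))]
  simpa using this

end Slice

/-! ### Log-concavity of volume, and its consequences for moments. -/

/-- The volume of Orlicz sublevel sets is a log-concave function of the level. -/
lemma logConcaveOn_volume_orliczSublevel {m : ℕ} {f : Fin m → ℝ → ℝ}
    (hf : ∀ i, IsYoungFunction (f i)) :
    LogConcaveOn Set.univ fun r => volume.real (orliczSublevel f r) := by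
  induction m with
  | zero =>
    have h : ∀ r, volume.real (orliczSublevel f r) = if 0 ≤ r then 1 else 0 := by
      intro r
      split_ifs with hr
      · have : orliczSublevel f r = Set.univ := by ext; simp [orliczSublevel, hr]
        simp [this, measureReal_def, volume_pi]
      · exact volume_orliczSublevel_of_neg hf (not_le.1 hr)
    intro x _ y _ a b ha hb _
    simp only [h]
    -- The volume may vanish; strict positivity of the weights then matters, since `0 ^ 0 = 1`.
    by_cases hx : 0 ≤ x
    · by_cases hy : 0 ≤ y
      · rw [if_pos hx, if_pos hy, if_pos (by positivity)]; simp
      · rw [if_neg hy, Real.zero_rpow hb.ne', mul_zero]; split_ifs <;> norm_num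
    · rw [if_neg hx, Real.zero_rpow ha.ne', zero_mul]; split_ifs <;> norm_num
  | succ m ih =>
    set V : ℝ → ℝ := fun r => volume.real (orliczSublevel ((0 : Fin (m + 1)).removeNth f) r)
    have hf' : ∀ i, IsYoungFunction ((0 : Fin (m + 1)).removeNth f i) := fun i => hf _
    have hV : LogConcaveOn Set.univ V := ih hf'
    have hVm : Monotone V := monotone_volume_orliczSublevel hf'
    have hV0 : ∀ r, 0 ≤ V r := fun r => measureReal_nonneg
    have anti : ∀ r, AntitoneOn (fun s => V (r - f 0 s)) (Set.Ici 0) := fun r s hs t ht hst =>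
      hVm (sub_le_sub_left ((hf 0).strictMonoOn.monotoneOn hs ht hst) r)
    have hint : ∀ r, IntegrableOn (fun s => V (r - f 0 s)) (Set.Ici 0) := by
      intro r
      refine (integrable_pow_mul_volume_slice hf r 0 0).integrableOn.congr_fun (fun s hs => ?_)
        measurableSet_Ici
      simp [V, abs_of_nonneg (Set.mem_Ici.1 hs)]
    intro x _ y _ a b ha hb hab
    simp only [volume_orliczSublevel_succ hf _ 0, ← integral_Ici_eq_integral_Ioi]
    have key := rpow_integral_mul_le_of_antitoneOn ha hb hab (anti x) (anti y)
      (anti (a * x + b * y)) (fun _ _ => hV0 _) (fun _ _ => hV0 _) (fun _ _ => hV0 _) (hint x)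
      (hint y) (hint _) (fun s hs t ht => by
        refine (hV (Set.mem_univ _) (Set.mem_univ _) ha hb hab).trans (hVm ?_)
        have := (hf 0).convexOn.2 hs ht ha.le hb.le hab
        simp only [smul_eq_mul] at this
        linarith)
    have hI : ∀ r, 0 ≤ ∫ s in Set.Ici 0, V (r - f 0 s) := fun r => integral_nonneg fun _ => hV0 _
    rw [Real.mul_rpow zero_le_two (hI x), Real.mul_rpow zero_le_two (hI y), mul_mul_mul_comm,
      ← Real.rpow_add two_pos, hab, Real.rpow_one]
    exact mul_le_mul_of_nonneg_left key zero_le_two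

/-- Fourth moments of coordinates on Orlicz sublevel sets. -/
lemma setIntegral_coord_pow_four_le {m : ℕ} {f : Fin (m + 1) → ℝ → ℝ}
    (hf : ∀ i, IsYoungFunction (f i)) (r : ℝ) (i : Fin (m + 1))
    (h0 : 0 < volume.real (orliczSublevel f r))
    (h2 : 0 < ∫ x in orliczSublevel f r, x i ^ 2) :
    (∫ x in orliczSublevel f r, x i ^ 4) * volume.real (orliczSublevel f r)
      ≤ 6 * (∫ x in orliczSublevel f r, x i ^ 2) ^ 2 := by
  set V : ℝ → ℝ := fun r => volume.real (orliczSublevel (i.removeNth f) r)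
  have hf' : ∀ k, IsYoungFunction (i.removeNth f k) := fun k => hf _
  have heven : ∀ k : ℕ, Even k → ∫ x in orliczSublevel f r, x i ^ k
      = 2 * ∫ s in Set.Ioi 0, s ^ k * V (r - f i s) := by
    intro k hk
    rw [setIntegral_coord_pow hf, ← integral_comp_abs (f := fun s => s ^ k * V (r - f i s))]
    simp [V, hk.pow_abs]
  have e0 : volume.real (orliczSublevel f r) = 2 * ∫ s in Set.Ioi 0, V (r - f i s) :=
    volume_orliczSublevel_succ hf r i
  obtain ⟨R, hR⟩ := (hf i).exists_bound r
  rw [e0] at h0 ⊢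
  rw [heven 2 even_two] at h2 ⊢
  rw [heven 4 (by decide)]
  have hg : LogConcaveOn (Set.Ici 0) fun s => V (r - f i s) :=
    (logConcaveOn_volume_orliczSublevel hf').comp_const_sub (monotone_volume_orliczSublevel hf')
      (hf i).convexOn r
  have key := hg.fourth_moment_le (R := max R 0) (fun s hs => by
      rw [max_lt_iff] at hs
      refine volume_orliczSublevel_of_neg hf' (not_le.1 fun h => ?_)
      exact absurd (hR s hs.2.le (by linarith)) (not_le.2 hs.1))
    (fun k => by
      refine IntegrableOn.congr_fun (integrable_pow_mul_volume_slice hf r i k).integrableOn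
        (fun s hs => ?_) measurableSet_Ioi
      simp [V, abs_of_pos (Set.mem_Ioi.1 hs)])
    (by linarith) (by linarith)
  nlinarith

/-- The mean square of a coordinate on an Orlicz sublevel set increases with the level. -/
lemma setIntegral_coord_sq_mul_volume_le {m : ℕ} {f : Fin (m + 1) → ℝ → ℝ}
    (hf : ∀ i, IsYoungFunction (f i)) (i : Fin (m + 1)) {r s : ℝ} (hrs : r ≤ s) :
    (∫ x in orliczSublevel f r, x i ^ 2) * volume.real (orliczSublevel f s)
      ≤ (∫ x in orliczSublevel f s, x i ^ 2) * volume.real (orliczSublevel f r) := by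
  have hf' : ∀ k, IsYoungFunction (i.removeNth f k) := fun k => hf _
  have hvol : ∀ r, volume.real (orliczSublevel f r)
      = ∫ t, volume.real (orliczSublevel (i.removeNth f) (r - f i |t|)) := fun r => by
    simpa using setIntegral_coord_pow hf r i 0
  have hint : ∀ r, Integrable fun t =>
      volume.real (orliczSublevel (i.removeNth f) (r - f i |t|)) := fun r => by
    simpa using integrable_pow_mul_volume_slice hf r i 0
  rw [hvol, hvol, setIntegral_coord_pow hf, setIntegral_coord_pow hf]
  refine integral_mul_mul_integral_le_of_antivary (hint r) (hint s)
    (integrable_pow_mul_volume_slice hf r i 2) (integrable_pow_mul_volume_slice hf s i 2)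
    fun t u htu => ?_
  have h := (hf i).strictMonoOn.monotoneOn (Set.mem_Ici.2 (abs_nonneg t))
    (Set.mem_Ici.2 (abs_nonneg u)) (sq_le_sq.1 htu)
  -- The levels `r - f i |u|` and `s - f i |t|` enclose `r - f i |t|` and `s - f i |u|`, with equal
  -- sums.
  exact (logConcaveOn_volume_orliczSublevel hf').mul_le_mul_of_add_eq
    (fun _ => measureReal_nonneg) (by linarith) (by linarith) (by ring)

/-- The squares of two different coordinates are negatively correlated on Orlicz sublevel sets. -/
lemma setIntegral_sq_mul_sq_le {m : ℕ} {f : Fin m → ℝ → ℝ}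
    (hf : ∀ i, IsYoungFunction (f i)) (r : ℝ) {i j : Fin m} (hij : i ≠ j) :
    (∫ x in orliczSublevel f r, x i ^ 2 * x j ^ 2) * volume.real (orliczSublevel f r)
      ≤ (∫ x in orliczSublevel f r, x i ^ 2) * ∫ x in orliczSublevel f r, x j ^ 2 := by
  -- Two distinct indices force dimension at least two, so the slices still have a coordinate.
  obtain _ | _ | m := m
  · exact i.elim0
  · exact absurd (by omega : i = j) hij
  obtain ⟨k, rfl⟩ := Fin.exists_succAbove_eq hij.symm
  have hf' : ∀ k, IsYoungFunction (i.removeNth f k) := fun k => hf _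
  obtain ⟨hi1, he1⟩ := orliczSublevel_slice hf r i (G := fun z => z.1 ^ 2 * z.2 k ^ 2)
    (by fun_prop)
  obtain ⟨hi2, he2⟩ := orliczSublevel_slice hf r i (G := fun z => z.2 k ^ 2) (by fun_prop)
  have hvol : volume.real (orliczSublevel f r)
      = ∫ t, volume.real (orliczSublevel (i.removeNth f) (r - f i |t|)) := by
    simpa using setIntegral_coord_pow hf r i 0
  have hint : Integrable fun t =>
      volume.real (orliczSublevel (i.removeNth f) (r - f i |t|)) := by
    simpa using integrable_pow_mul_volume_slice hf r i 0
  simp only [integral_const_mul] at hi1 he1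
  simp only [Fin.removeNth_apply] at he1 he2
  rw [he1, he2, hvol, setIntegral_coord_pow hf]
  -- The weights are the integral of `y k ^ 2` over the slice and the slice's volume; their ratio
  -- decreases as `t ^ 2` grows.
  refine integral_mul_mul_integral_le_of_antivary hi2 hint hi1
    (integrable_pow_mul_volume_slice hf r i 2) fun t u htu => ?_
  have h := (hf i).strictMonoOn.monotoneOn (Set.mem_Ici.2 (abs_nonneg t))
    (Set.mem_Ici.2 (abs_nonneg u)) (sq_le_sq.1 htu)
  exact setIntegral_coord_sq_mul_volume_le hf' k (by linarith)

/-! ### Isotropic balls in Euclidean space and the variance bound. -/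

lemma orliczBall_eq_preimage {n : ℕ} (f : Fin n → ℝ → ℝ) :
    orliczBall f = WithLp.ofLp ⁻¹' orliczSublevel f 1 := rfl

lemma setIntegral_orliczBall {n : ℕ} (f : Fin n → ℝ → ℝ) (G : (Fin n → ℝ) → ℝ) :
    ∫ x in orliczBall f, G x.ofLp = ∫ x in orliczSublevel f 1, G x :=
  (PiLp.volume_preserving_ofLp (Fin n)).setIntegral_preimage_emb
    (MeasurableEquiv.toLp 2 (Fin n → ℝ)).symm.measurableEmbedding G
    (orliczSublevel f 1)

lemma Continuous.integrableOn_orliczBall {n : ℕ} {f : Fin n → ℝ → ℝ}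
    (hf : ∀ i, IsYoungFunction (f i)) {G : (Fin n → ℝ) → ℝ} (hG : Continuous G) :
    IntegrableOn (fun x : EuclideanSpace ℝ (Fin n) => G x.ofLp) (orliczBall f) :=
  ((PiLp.volume_preserving_ofLp (Fin n)).integrableOn_comp_preimage
    (MeasurableEquiv.toLp 2 (Fin n → ℝ)).symm.measurableEmbedding).2
    (hG.integrableOn_orliczSublevel hf 1)

section Isotropic

variable {n : ℕ} {f : Fin n → ℝ → ℝ} {L : ℝ}

/-- Negative correlation handles `i ≠ j` and the fourth-moment bound `6 L⁴` handles `i = j`.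
Separating the common `L⁴` lets it cancel against the squared mean when summed. -/
lemma IsIsotropicWith.integral_sq_mul_sq_le (hf : ∀ i, IsYoungFunction (f i))
    (hL : IsIsotropicWith (orliczBall f) L) (i j : Fin n) :
    ∫ x in orliczBall f, x i ^ 2 * x j ^ 2 ≤ L ^ 4 + if i = j then 5 * L ^ 4 else 0 := by
  have hvol : volume.real (orliczSublevel f 1) = 1 := by
    have := (PiLp.volume_preserving_ofLp (Fin n)).measure_preimage
      (measurableSet_orliczSublevel hf 1).nullMeasurableSet
    rw [← orliczBall_eq_preimage, hL.volume_eq_one] at this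
    simp [measureReal_def, ← this]
  have hsq : ∀ i, ∫ x in orliczSublevel f 1, x i ^ 2 = L ^ 2 := by
    intro i
    have h := hL.cov_eq i i
    rw [if_pos rfl] at h
    rw [← h, ← setIntegral_orliczBall f fun x => x i ^ 2]
    simp only [sq, uniformMeasureOn]
  rw [setIntegral_orliczBall f fun x => x i ^ 2 * x j ^ 2]
  split_ifs with hij
  · subst hij
    obtain _ | m := n
    · exact i.elim0
    have h := setIntegral_coord_pow_four_le hf 1 i (by rw [hvol]; exact one_pos)
      (by rw [hsq]; exact pow_pos hL.pos 2)
    rw [hvol, hsq, mul_one] at h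
    simp only [← pow_add]
    exact h.trans_eq (by ring)
  · have h := setIntegral_sq_mul_sq_le hf 1 hij
    rw [hvol, hsq, hsq, mul_one] at h
    exact h.trans_eq (by ring)

/-- The variance of the squared Euclidean norm on an isotropic generalized Orlicz ball. -/
lemma IsIsotropicWith.integral_sq_norm_sq_div_sub_le (hn : 1 ≤ n)
    (hf : ∀ i, IsYoungFunction (f i)) (hL : IsIsotropicWith (orliczBall f) L) :
    IntegrableOn (fun x : EuclideanSpace ℝ (Fin n) => (‖x‖ ^ 2 / n - L ^ 2) ^ 2) (orliczBall f) ∧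
    ∫ x in orliczBall f, (‖x‖ ^ 2 / (n : ℝ) - L ^ 2) ^ 2 ≤ 5 * L ^ 4 / n := by
  have hn0 : (0 : ℝ) < n := by exact_mod_cast hn
  have hsq : ∀ i, ∫ x in orliczBall f, x i ^ 2 = L ^ 2 := by
    intro i
    have h := hL.cov_eq i i
    rw [if_pos rfl] at h
    rw [← h]
    simp only [sq, uniformMeasureOn]
  have hexp : ∀ x : EuclideanSpace ℝ (Fin n), (‖x‖ ^ 2 / (n : ℝ) - L ^ 2) ^ 2
      = 1 / (n : ℝ) ^ 2 * ∑ i, ∑ j, x i ^ 2 * x j ^ 2 - 2 * L ^ 2 / n * ∑ i, x i ^ 2 + L ^ 4 := by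
    intro x
    rw [EuclideanSpace.real_norm_sq_eq, ← Finset.sum_mul_sum]
    field_simp
    ring
  have i1 : ∀ i j, IntegrableOn (fun x : EuclideanSpace ℝ (Fin n) => x i ^ 2 * x j ^ 2)
      (orliczBall f) := fun i j =>
    Continuous.integrableOn_orliczBall hf (G := fun x => x i ^ 2 * x j ^ 2) (by fun_prop)
  have i2 : ∀ i, IntegrableOn (fun x : EuclideanSpace ℝ (Fin n) => x i ^ 2) (orliczBall f) :=
    fun i => Continuous.integrableOn_orliczBall hf (G := fun x => x i ^ 2) (by fun_prop)
  have i3 : IntegrableOn (fun _ : EuclideanSpace ℝ (Fin n) => L ^ 4) (orliczBall f) :=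
    Continuous.integrableOn_orliczBall hf (G := fun _ => L ^ 4) (by fun_prop)
  have I1 : IntegrableOn (fun x : EuclideanSpace ℝ (Fin n) =>
      1 / (n : ℝ) ^ 2 * ∑ i, ∑ j, x i ^ 2 * x j ^ 2) (orliczBall f) :=
    (integrable_finsetSum _ fun i _ => integrable_finsetSum _ fun j _ => i1 i j).const_mul _
  have I2 : IntegrableOn (fun x : EuclideanSpace ℝ (Fin n) => 2 * L ^ 2 / n * ∑ i, x i ^ 2)
      (orliczBall f) := (integrable_finsetSum _ fun i _ => i2 i).const_mul _
  simp only [hexp]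
  refine ⟨(I1.sub I2).add i3, ?_⟩
  rw [integral_add (by exact I1.sub I2) i3, integral_sub I1 I2, integral_const_mul,
    integral_const_mul,
    integral_finsetSum _ fun i _ => integrable_finsetSum _ fun j _ => i1 i j,
    integral_finsetSum _ fun i _ => i2 i]
  simp only [hsq, integral_finsetSum _ fun j _ => i1 _ j]
  have hvol : volume.real (orliczBall f) = 1 := by simp [measureReal_def, hL.volume_eq_one]
  have hle : ∑ i, ∑ j, ∫ x in orliczBall f, x i ^ 2 * x j ^ 2
      ≤ (n : ℝ) ^ 2 * L ^ 4 + 5 * n * L ^ 4 := by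
    refine (Finset.sum_le_sum fun i _ => Finset.sum_le_sum fun j _ =>
      hL.integral_sq_mul_sq_le hf i j).trans_eq ?_
    simp [Finset.sum_add_distrib]
    ring
  have hle' := mul_le_mul_of_nonneg_left hle (by positivity : (0 : ℝ) ≤ 1 / (n : ℝ) ^ 2)
  have e : 1 / (n : ℝ) ^ 2 * ((n : ℝ) ^ 2 * L ^ 4 + 5 * n * L ^ 4) = L ^ 4 + 5 * L ^ 4 / n := by
    field_simp
  have e2 : 2 * L ^ 2 / n * ∑ _i : Fin n, L ^ 2 = 2 * L ^ 4 := by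
    simp; field_simp
  rw [e2]
  simp only [setIntegral_const, hvol, one_smul]
  linarith

end Isotropic

/-! ### Concentration from the variance bound. -/

theorem corollary3p4 (n : ℕ) (hn : 1 ≤ n) (K : Set (EuclideanSpace ℝ (Fin n)))
    (hK : IsGeneralizedOrliczBall K) (L : ℝ) (hL : IsIsotropicWith K L) :
    (∀ t : ℝ, 0 < t →
      (uniformMeasureOn K).real {x | t ≤ |‖x‖ ^ 2 / (n : ℝ) - L ^ 2|} ≤ 5 * L ^ 4 / ((n : ℝ) * t ^ 2) ∧
      (uniformMeasureOn K).real {x | t ≤ |‖x‖ / √(n : ℝ) - L|} ≤ 5 * L ^ 2 / ((n : ℝ) * t ^ 2)) ∧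
    ConcentrationHypothesis K L (√5 * (n : ℝ) ^ (-(1 / 3) : ℝ)) := by
  obtain ⟨f, hf, rfl⟩ := hK
  have hn0 : (0 : ℝ) < n := by exact_mod_cast hn
  have hL0 := hL.pos
  obtain ⟨hint, hvar⟩ := hL.integral_sq_norm_sq_div_sub_le hn hf
  have : IsProbabilityMeasure (uniformMeasureOn (orliczBall f)) :=
    ⟨by simp [uniformMeasureOn, hL.volume_eq_one]⟩
  have sq_bound : ∀ t : ℝ, 0 < t →
      (uniformMeasureOn (orliczBall f)).real {x | t ≤ |‖x‖ ^ 2 / (n : ℝ) - L ^ 2|}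
        ≤ 5 * L ^ 4 / ((n : ℝ) * t ^ 2) := by
    intro t ht
    have h := mul_meas_ge_le_integral_of_nonneg (μ := uniformMeasureOn (orliczBall f))
      (Filter.Eventually.of_forall fun x => sq_nonneg _) hint (t ^ 2)
    have hs : {x : EuclideanSpace ℝ (Fin n) | t ^ 2 ≤ (‖x‖ ^ 2 / (n : ℝ) - L ^ 2) ^ 2}
        = {x | t ≤ |‖x‖ ^ 2 / (n : ℝ) - L ^ 2|} := by
      ext x
      rw [Set.mem_ofPred_eq, Set.mem_ofPred_eq]
      rw [sq_le_sq, abs_of_pos ht]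
    rw [hs] at h
    have h' := h.trans hvar
    rw [le_div_iff₀ hn0] at h'
    rw [le_div_iff₀ (by positivity)]
    linarith
  have norm_bound : ∀ t : ℝ, 0 < t →
      (uniformMeasureOn (orliczBall f)).real {x | t ≤ |‖x‖ / √(n : ℝ) - L|}
        ≤ 5 * L ^ 2 / ((n : ℝ) * t ^ 2) := by
    intro t ht
    refine (measureReal_mono (fun x hx => ?_)).trans ((sq_bound (t * L) (by positivity)).trans_eq ?_)
    · have hx : t ≤ |‖x‖ / √(n : ℝ) - L| := hx
      change t * L ≤ |‖x‖ ^ 2 / (n : ℝ) - L ^ 2|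
      -- The second factor is at least `L`, so a deviation `t` of the norm forces a deviation `t *
      -- L` of its square.
      have e : ‖x‖ ^ 2 / (n : ℝ) - L ^ 2 = (‖x‖ / √(n : ℝ) - L) * (‖x‖ / √(n : ℝ) + L) := by
        nth_rewrite 1 [← Real.sq_sqrt hn0.le]
        ring
      have hx0 : 0 ≤ ‖x‖ / √(n : ℝ) := by positivity
      rw [e, abs_mul, abs_of_pos (by linarith : 0 < ‖x‖ / √(n : ℝ) + L)]
      exact mul_le_mul hx (by linarith) hL0.le (abs_nonneg _)
    · field_simp
  refine ⟨fun t ht => ⟨sq_bound t ht, norm_bound t ht⟩, by positivity, ?_⟩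
  set c : ℝ := (n : ℝ) ^ (-(1 / 3) : ℝ) with hc
  have hc0 : 0 < c := by positivity
  have hc3 : c ^ 3 * n = 1 := by
    rw [hc, ← Real.rpow_natCast, ← Real.rpow_mul hn0.le]
    norm_num
    rw [Real.rpow_neg_one, inv_mul_cancel₀ hn0.ne']
  have h5 : (1 : ℝ) ≤ √5 := Real.one_le_sqrt.2 (by norm_num)
  refine (norm_bound (√5 * c * L) (by positivity)).trans ?_
  have h55 : √5 ^ 2 = 5 := Real.sq_sqrt (by norm_num)
  rw [mul_pow, mul_pow, h55, div_le_iff₀ (by positivity)]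
  -- At `t = √5 c L` the bound equals `1 / (n c²) = c`, which is at most `√5 c`.
  calc 5 * L ^ 2 = 5 * L ^ 2 * (c ^ 3 * n) := by rw [hc3, mul_one]
    _ ≤ √5 * (5 * L ^ 2 * (c ^ 3 * n)) := le_mul_of_one_le_left (by positivity) h5
    _ = √5 * c * (n * (5 * c ^ 2 * L ^ 2)) := by ring
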